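/- **Setting.** Consider the semidefinite program $\min\{\langle C,X\rangle : X\succeq 0,\ \langle A_i,X\rangle\le b_i,\ i=1,\dots,m\}$ with symmetric data $C,A_1,\dots,A_m\in\mathbb S^n$ and $b\in\mathbb R^m$. Its aggregate sparsity graph $G=(V,E)$ has $V=\{1,\dots,n\}$ and an edge between $i\ne j$ whenever $C[i,j]\ne 0$ or $A_k[i,j]\ne0$ for some $k$. The extended graph $\overline G\supseteq G$ additionally makes, for each $k$, the set $\operatorname{supp}(A_k)$ of indices of nonzero rows of $A_k$ a clique. Let $\tau_\star=\operatorname{tw}(G)$ be the treewidth of $G$. *Chordal conversion* with accuracy $\epsilon>0$ and permutation matrix $\Pi$ works as follows. (1) Replace $C,A_i$ by $\Pi C\Pi^T,\Pi A_i\Pi^T$, compute the aggregate sparsity pattern, its symbolic Cholesky factor $F$, and the column sets $J_j=\{j\}\cup\{i>j:(i,j)\in F\}$. (2) Call a general-purpose interior-point solver with accuracy $\epsilon$ on $\max\{\langle -C,Y\rangle : \langle A_i,Y\rangle\le b_i\ \forall i,\ Y[J_j,J_j]\succeq0\ \forall j\}$ over symmetric $Y$ with pattern $F$, written in the vectorized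 form $\max\{\mathbf b^Ty:\mathbf c-\mathbf A^Ty\in\mathcal K\}$, $y=\operatorname{svec}_F(Y)$, where $\mathcal K$ is a product of semidefinite cones. (3) With $\delta=-\min_j\{0,\lambda_{\min}(Y[J_j,J_j])\}$, find $\tilde U\in\mathbb R^{n\times\omega}$, $\omega=\max_j|J_j|$, with $(\tilde U\tilde U^T)[J_j,J_j]=Y[J_j,J_j]+\delta I$ for all $j$, and output $U=\Pi^T\tilde U$ and the multipliers $v$. A *general-purpose solver* performs at least one iteration. Each iteration consists of some overhead and of solving at least one Schur complement equation $\mathbf H\,\Delta y=r$, $\mathbf H=\mathbf A\nabla^2f(w)\mathbf A^T$, $f=-\log\det$, $w\in\operatorname{Int}\mathcal K$, by forming $\mathbf H$, computing a sparse Cholesky factorization $L=\operatorname{chol}(Q\mathbf HQ^T)$ on the sparsity pattern of $\mathbf H$ aggregated over all $w$, and substituting forward and backward; here $Q$ is any permutation whose frontsize (the largest number of nonzeros in a column of the symbolic Cholesky factor) is no worse than that of the natural ordering. On a standard-form program with cones of total order $N'$ and largest order $\omega'$ it needs $O(\sqrt{N'}\log(1/\epsilon))$ iterations, each with $O(1)$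 Schur complement equations and an overhead of $O(\omega'^2N')$ time and $O(\omega' N')$ memory. Time is the number of arithmetic operations; memory is the peak number of stored reals. **Corollary (lower complexity).** There is a universal constant $c>0$ such that for all $n,m$, all symmetric $C,A_1,\dots,A_m\in\mathbb S^n$ and $b\in\mathbb R^m$, every permutation $\Pi$, every general-purpose solver and every $\epsilon>0$, every execution of chordal conversion takes at least $$c\,(\tau_\star^6+m+n)\ \text{time}\qquad\text{and}\qquad c\,(\tau_\star^4+m+n)\ \text{memory}.$$ That is, no choice of $\Pi$ lets chordal conversion solve the SDP to arbitrary accuracy in less than $\Omega(\tau_\star^6+m+n)$ time and $\Omega(\tau_\star^4+m+n)$ memory. This shows that the known upper bounds of $O(\overline\omega^4N)$ time and $O(\overline\omega^2N)$ memory per iteration, where $N=m+\overline\omega n$ and $\overline\omega=1+\overline\tau$ for a tree decomposition of $\overline G$ of width $\overline\tau$, are sharp when $G=\overline G$: there is a universal $c>0$ such that for every $\tau\ge0$ and every $m\le(\tau+1)^2$ there is an instance with $m$ constraints, with strong duality attained, $G=\overline G$ and $\operatorname{tw}(\overline G)=\tau$, for which, for every $\Pi$, every general-purpose solver and every $\epsilon>0$,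 every iteration costs at least $c\,\overline\omega^4N$ time and $c\,\overline\omega^2N$ memory, where $\overline\omega=1+\tau$. -/

import Mathlib

/-!
Chordal conversion of sparse semidefinite programs: sparsity patterns, treewidth, the standard-form
conic program produced by the conversion, sparse Cholesky factorization with explicit operation and
storage counts, general-purpose interior-point solvers, and executions of the whole algorithm.
-/

noncomputable section

namespace ChordalConv

/-! ## Sparsity patterns and symbolic Cholesky factorization -/

/-- A sparsity pattern of order `n`; only entries `(i, j)` with `j ≤ i` are used. -/
abbrev Pattern (n : ℕ) := Finset (Fin n × Fin n)

open Classical in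
/-- The minimum (lower-triangular) sparsity pattern of a symmetric matrix. -/
def spar {n : ℕ} (X : Matrix (Fin n) (Fin n) ℝ) : Pattern n :=
  Finset.univ.filter fun e => e.2 ≤ e.1 ∧ X e.1 e.2 ≠ 0

/-- The dense pattern on a set of indices. -/
def cliquePattern {n : ℕ} (J : Finset (Fin n)) : Pattern n :=
  (J ×ˢ J).filter fun e => e.2 ≤ e.1

open Classical in
/-- The indices of the nonzero rows of a matrix. -/
def vsupp {n : ℕ} (M : Matrix (Fin n) (Fin n) ℝ) : Finset (Fin n) :=
  Finset.univ.filter fun i => ∃ j, M i j ≠ 0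

/-- The aggregate sparsity pattern of the data `C, A₁, …, Aₘ`. -/
def aggPattern {n m : ℕ} (C : Matrix (Fin n) (Fin n) ℝ)
    (A : Fin m → Matrix (Fin n) (Fin n) ℝ) : Pattern n :=
  spar C ∪ Finset.univ.biUnion fun i => spar (A i)

/-- The extended aggregate sparsity pattern, in which every `Aᵢ` is its own clique. -/
def extPattern {n m : ℕ} (C : Matrix (Fin n) (Fin n) ℝ)
    (A : Fin m → Matrix (Fin n) (Fin n) ℝ) : Pattern n :=
  spar C ∪ Finset.univ.biUnion fun i => cliquePattern (vsupp (A i))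

/-- The undirected graph of a sparsity pattern. -/
def patternGraph {n : ℕ} (E : Pattern n) : SimpleGraph (Fin n) :=
  SimpleGraph.fromRel fun i j => (i, j) ∈ E

/-- Elimination of the index `k` in the symbolic Cholesky factorization. -/
def cholStep {n : ℕ} (E : Pattern n) (k : Fin n) : Pattern n :=
  E ∪ {(k, k)} ∪
    Finset.univ.filter fun e => (e.1, k) ∈ E ∧ (e.2, k) ∈ E ∧ e.2 < e.1 ∧ k < e.2

/-- The symbolic Cholesky factor: eliminate all indices in increasing order. -/
def symbChol {n : ℕ} (E : Pattern n) : Pattern n :=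
  (List.finRange n).foldl cholStep E

/-- The strictly subdiagonal part of the `j`-th column. -/
def below {n : ℕ} (F : Pattern n) (j : Fin n) : Finset (Fin n) :=
  Finset.univ.filter fun i => j < i ∧ (i, j) ∈ F

/-- The `j`-th column set `{j} ∪ {i > j : (i, j) ∈ F}`. -/
def col {n : ℕ} (F : Pattern n) (j : Fin n) : Finset (Fin n) :=
  insert j (below F j)

/-- The frontsize: the largest column of the symbolic Cholesky factor. -/
def frontsize {n : ℕ} (E : Pattern n) : ℕ :=
  Finset.univ.sup fun j => (col (symbChol E) j).card

/-- The pattern of `Q S Qᵀ` when `S` is symmetric with (lower-triangular) pattern `E` and `Q` is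
the permutation matrix with `(Q S Qᵀ) i j = S (σ i) (σ j)`. -/
def permPattern {n : ℕ} (σ : Equiv.Perm (Fin n)) (E : Pattern n) : Pattern n :=
  Finset.univ.filter fun e => e.2 ≤ e.1 ∧ ((σ e.1, σ e.2) ∈ E ∨ (σ e.2, σ e.1) ∈ E)

/-! ## Treewidth -/

/-- A tree decomposition of a finite graph, with nodes `0, …, k - 1`. -/
structure TreeDecomposition {V : Type} [DecidableEq V] (G : SimpleGraph V) where
  k : ℕ
  tree : SimpleGraph (Fin k)
  isTree : tree.IsTree
  bag : Fin k → Finset V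
  vertexCover : ∀ v, ∃ t, v ∈ bag t
  edgeCover : ∀ u v, G.Adj u v → ∃ t, u ∈ bag t ∧ v ∈ bag t
  runningIntersection : ∀ (s t : Fin k) (p : tree.Walk s t), p.IsPath →
    ∀ r ∈ p.support, bag s ∩ bag t ⊆ bag r

/-- The width: the largest size of a bag, minus one. -/
def TreeDecomposition.width {V : Type} [DecidableEq V] {G : SimpleGraph V}
    (D : TreeDecomposition G) : ℕ :=
  (Finset.univ.sup fun t => (D.bag t).card) - 1

/-- The treewidth: the minimum width of a tree decomposition (`0` for the empty graph). -/
def treewidth {V : Type} [DecidableEq V] (G : SimpleGraph V) : ℕ :=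
  sInf (Set.range fun D : TreeDecomposition G => D.width)

/-! ## Symmetric vectorization -/

/-- The lower-triangular positions of a matrix of order `k`. -/
abbrev LowerIdx (k : ℕ) := {e : Fin k × Fin k // e.2 ≤ e.1}

/-- The coordinate of `X` at position `(i, j)`, `i ≥ j`: the entry itself on the diagonal, and
`√2` times the entry off the diagonal. -/
def symCoord {n : ℕ} (X : Matrix (Fin n) (Fin n) ℝ) (e : Fin n × Fin n) : ℝ :=
  if e.1 = e.2 then X e.1 e.2 else √2 * X e.1 e.2

/-- The symmetric matrix whose only nonzero coordinate is a `1` at position `(i, j)`. -/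
def symUnit {n : ℕ} (e : Fin n × Fin n) : Matrix (Fin n) (Fin n) ℝ :=
  if e.1 = e.2 then Matrix.single e.1 e.1 1
  else (√2)⁻¹ • (Matrix.single e.1 e.2 1 + Matrix.single e.2 e.1 1)

/-- Symmetric vectorization of a matrix of order `k`. -/
def svec {k : ℕ} (X : Matrix (Fin k) (Fin k) ℝ) : LowerIdx k → ℝ := fun u => symCoord X u.1

/-- The inverse of symmetric vectorization. -/
def smat {k : ℕ} (x : LowerIdx k → ℝ) : Matrix (Fin k) (Fin k) ℝ := ∑ u, x u • symUnit u.1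

/-- The entries of a pattern `F`, each written as `(column, row)` and ordered lexicographically:
this is the column-stacking (raster) ordering. -/
def raster {n : ℕ} (F : Pattern n) : Finset (Fin n ×ₗ Fin n) :=
  F.image fun e => toLex (e.2, e.1)

/-- The number of coordinates of symmetric vectorization with respect to `F`. -/
abbrev rasterCard {n : ℕ} (F : Pattern n) : ℕ := (raster F).card

/-- The position `(row, column)` of the `α`-th coordinate in the raster ordering. -/
def entry {n : ℕ} (F : Pattern n) (α : Fin (rasterCard F)) : Fin n × Fin n :=
  ((ofLex ((raster F).orderEmbOfFin rfl α)).2, (ofLex ((raster F).orderEmbOfFin rfl α)).1)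

/-- Symmetric vectorization of a matrix with pattern `F`. -/
def svecF {n : ℕ} (F : Pattern n) (X : Matrix (Fin n) (Fin n) ℝ) : Fin (rasterCard F) → ℝ :=
  fun α => symCoord X (entry F α)

/-- The symmetric matrix with pattern `F` and given coordinates. -/
def smatF {n : ℕ} (F : Pattern n) (y : Fin (rasterCard F) → ℝ) : Matrix (Fin n) (Fin n) ℝ :=
  ∑ α, y α • symUnit (entry F α)

/-- The principal submatrix `X[J, J]`, indexed by `0, …, |J| - 1` in increasing order. -/
def principal {n : ℕ} (J : Finset (Fin n)) (X : Matrix (Fin n) (Fin n) ℝ) :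
    Matrix (Fin J.card) (Fin J.card) ℝ :=
  X.submatrix (J.orderEmbOfFin rfl) (J.orderEmbOfFin rfl)

/-! ## Standard-form conic programs -/

/-- Data `(𝐀, 𝐛, 𝐜, 𝒦)` of the primal-dual pair `min {𝐜ᵀx : 𝐀x = 𝐛, x ∈ 𝒦}`,
`max {𝐛ᵀy : 𝐜 - 𝐀ᵀy ∈ 𝒦}`, where `𝒦` is the product over `k : ι` of the (vectorized)
semidefinite cones of order `ord k`. -/
structure ConicSDP where
  ι : Type
  fintypeι : Fintype ι
  decEqι : DecidableEq ι
  ord : ι → ℕ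
  p : ℕ
  A : Matrix (Fin p) ((k : ι) × LowerIdx (ord k)) ℝ
  b : Fin p → ℝ
  c : ((k : ι) × LowerIdx (ord k)) → ℝ

attribute [instance] ConicSDP.fintypeι ConicSDP.decEqι

namespace ConicSDP

/-- The index set of the coordinates of `x`. -/
abbrev Col (P : ConicSDP) := (k : P.ι) × LowerIdx (P.ord k)

/-- The block of order `ord k` of a vector. -/
def blk (P : ConicSDP) (x : P.Col → ℝ) (k : P.ι) : Matrix (Fin (P.ord k)) (Fin (P.ord k)) ℝ :=
  smat fun u => x ⟨k, u⟩

/-- Membership in the cone `𝒦`, which is self-dual. -/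
def InCone (P : ConicSDP) (x : P.Col → ℝ) : Prop := ∀ k, (P.blk x k).PosSemidef

/-- The identity element of the cone. -/
def oneK (P : ConicSDP) : P.Col → ℝ := fun u => svec (1 : Matrix (Fin (P.ord u.1)) _ ℝ) u.2

/-- The sum of the orders of the cones. -/
def totalOrder (P : ConicSDP) : ℕ := ∑ k, P.ord k

/-- The largest order of a cone. -/
def maxOrder (P : ConicSDP) : ℕ := Finset.univ.sup P.ord

/-- The regularity assumptions on a standard-form program: at least one cone, cones of positive
order, linear independence, and strong duality attained. -/
structure IsStandardForm (P : ConicSDP) : Prop where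
  nonempty : Nonempty P.ι
  ord_pos : ∀ k, 1 ≤ P.ord k
  linIndep : ∀ y, P.A.transpose.mulVec y = 0 → y = 0
  strongDuality : ∃ x y, P.A.mulVec x = P.b ∧ P.InCone x ∧
    P.InCone (P.c - P.A.transpose.mulVec y) ∧ P.c ⬝ᵥ x = P.b ⬝ᵥ y

/-- A scaling point: a point `w = (svec W_k)_k` in the interior of the cone. -/
structure ScalingPoint (P : ConicSDP) where
  W : (k : P.ι) → Matrix (Fin (P.ord k)) (Fin (P.ord k)) ℝ
  posDef : ∀ k, (W k).PosDef

/-- The Hessian of `-log det` at `W ≻ 0` in vectorized coordinates: the matrix `𝐃` with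
`𝐃 svec(X) = svec(W⁻¹ X W⁻¹)`. -/
def blockHess {k : ℕ} (W : Matrix (Fin k) (Fin k) ℝ) : Matrix (LowerIdx k) (LowerIdx k) ℝ :=
  Matrix.of fun u v => (symUnit u.1 * W⁻¹ * symUnit v.1 * W⁻¹).trace

/-- The Schur complement matrix `𝐇 = 𝐀 ∇²f(w) 𝐀ᵀ`. -/
def schurMatrix (P : ConicSDP) (w : P.ScalingPoint) : Matrix (Fin P.p) (Fin P.p) ℝ :=
  P.A * Matrix.blockDiagonal' (fun k => blockHess (w.W k)) * P.A.transpose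

open Classical in
/-- The sparsity pattern of the Schur complement matrix, aggregated over all scaling points. -/
def schurPattern (P : ConicSDP) : Pattern P.p :=
  Finset.univ.filter fun e => e.2 ≤ e.1 ∧ ∃ w : P.ScalingPoint, P.schurMatrix w e.1 e.2 ≠ 0

open Classical in
/-- The number of nonzeros of the data matrix. -/
def nnzA (P : ConicSDP) : ℕ :=
  (Finset.univ.filter fun e : Fin P.p × P.Col => P.A e.1 e.2 ≠ 0).card

end ConicSDP

/-! ## Programs with operation and storage counts -/

/-- The result of a straight-line real-number computation, together with the number of arithmetic
operations it performed and the number of units of memory it allocated. -/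
structure Prog (α : Type) where
  val : α
  time : ℕ
  mem : ℕ

instance : Monad Prog where
  pure a := ⟨a, 0, 0⟩
  bind x f := ⟨(f x.val).val, x.time + (f x.val).time, x.mem + (f x.val).mem⟩

/-- One arithmetic operation (in particular, one fused multiply-add), with result `a`. -/
def op {α : Type} (a : α) : Prog α := ⟨a, 1, 0⟩

/-- Allocation of `k` units of memory, each of which holds one real number. -/
def alloc (k : ℕ) : Prog Unit := ⟨(), 0, k⟩

/-- Matrix storage; only positions on and below the diagonal are used. -/
abbrev Store (p : ℕ) := Fin p × Fin p → ℝ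

open Classical in
/-- Forming the lower triangle of `𝐇 = 𝐀 ∇²f(w) 𝐀ᵀ`. For every cone and every entry `d` of its
Hessian block (one operation per entry), `d` is accumulated at all positions where the two
columns of `𝐀` involved are nonzero (one operation per position). -/
def formSchur (P : ConicSDP) (w : P.ScalingPoint) : Prog (Store P.p) :=
  (Finset.univ : Finset P.ι).toList.foldlM (fun H k =>
    (Finset.univ : Finset (LowerIdx (P.ord k) × LowerIdx (P.ord k))).toList.foldlM (fun H uv => do
      let d ← op (ConicSDP.blockHess (w.W k) uv.1 uv.2)
      (Finset.univ.filter fun e : Fin P.p × Fin P.p =>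
          e.2 ≤ e.1 ∧ P.A e.1 ⟨k, uv.1⟩ ≠ 0 ∧ P.A e.2 ⟨k, uv.2⟩ ≠ 0).toList.foldlM (fun H e => do
        let h ← op (H e + P.A e.1 ⟨k, uv.1⟩ * d * P.A e.2 ⟨k, uv.2⟩)
        pure (Function.update H e h)) H) H)
    (fun _ => 0)

/-- The pairs `(i, k)` with `i ≥ k` that are updated when column `j` is eliminated. -/
def updatePairs {p : ℕ} (F : Pattern p) (j : Fin p) : Finset (Fin p × Fin p) :=
  (below F j ×ˢ below F j).filter fun e => e.2 ≤ e.1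

/-- In-place sparse Cholesky factorization `S = L Lᵀ` with the zero-fill pattern `F`: for each
column, one square root, one division per subdiagonal entry, and one multiply-subtract per entry of
the rank-one update of the remaining matrix. The factor is stored entry by entry. -/
def sparseChol {p : ℕ} (F : Pattern p) (S : Store p) : Prog (Store p) := do
  alloc F.card
  (List.finRange p).foldlM (fun S j => do
    let d ← op (√(S (j, j)))
    let S ← (below F j).toList.foldlM (fun S i => do
      let l ← op (S (i, j) / d)
      pure (Function.update S (i, j) l)) (Function.update S (j, j) d)
    (updatePairs F j).toList.foldlM (fun S e => do
      let s ← op (S e - S (e.1, j) * S (e.2, j))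
      pure (Function.update S e s)) S) S

/-- Forward substitution `L z = r`. -/
def forwardSolve {p : ℕ} (F : Pattern p) (L : Store p) (r : Fin p → ℝ) : Prog (Fin p → ℝ) :=
  (List.finRange p).foldlM (fun z j => do
    let a ← op (z j / L (j, j))
    (below F j).toList.foldlM (fun z i => do
      let s ← op (z i - L (i, j) * a)
      pure (Function.update z i s)) (Function.update z j a)) r

/-- Backward substitution `Lᵀ x = z`. -/
def backwardSolve {p : ℕ} (F : Pattern p) (L : Store p) (z : Fin p → ℝ) : Prog (Fin p → ℝ) :=
  (List.finRange p).reverse.foldlM (fun x j => do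
    let x ← (below F j).toList.foldlM (fun x i => do
      let s ← op (x j - L (i, j) * x i)
      pure (Function.update x j s)) x
    let a ← op (x j / L (j, j))
    pure (Function.update x j a)) z

/-- Solving the Schur complement equation `𝐀 ∇²f(w) 𝐀ᵀ Δy = r`: store the data (the nonzeros of
`𝐀`, the scaling point and the right-hand side), form `𝐇`, factor `L = chol(Q 𝐇 Qᵀ)` on the
symbolic pattern, where `Q` is the permutation matrix of the ordering `σ`, and solve `L z = Q r`,
`Lᵀ (Q Δy) = z`. -/
def solveSchur (P : ConicSDP) (σ : Equiv.Perm (Fin P.p)) (w : P.ScalingPoint) (r : Fin P.p → ℝ) :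
    Prog (Fin P.p → ℝ) := do
  let F := symbChol (permPattern σ P.schurPattern)
  alloc (P.nnzA + Fintype.card P.Col + P.p)
  let H ← formSchur P w
  let L ← sparseChol F (fun e => H (max (σ e.1) (σ e.2), min (σ e.1) (σ e.2)))
  let z ← forwardSolve F L (fun i => r (σ i))
  let x ← backwardSolve F L z
  pure (fun i => x (σ.symm i))

/-! ## General-purpose interior-point solvers -/

/-- One instance of the Schur complement equation that a solver solves; the fill-reducing ordering
`σ` is no worse than the natural one. -/
structure SchurInstance (P : ConicSDP) where
  w : P.ScalingPoint
  r : Fin P.p → ℝ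
  σ : Equiv.Perm (Fin P.p)
  no_worse : frontsize (permPattern σ P.schurPattern) ≤ frontsize P.schurPattern

/-- The solution of the instance, as a program. -/
def SchurInstance.run {P : ConicSDP} (s : SchurInstance P) : Prog (Fin P.p → ℝ) :=
  solveSchur P s.σ s.w s.r

/-- One iteration of an interior-point method: some overhead, and at least one instance of the
Schur complement equation. -/
structure Iteration (P : ConicSDP) where
  overheadTime : ℕ
  overheadMem : ℕ
  instances : List (SchurInstance P)
  instances_ne : instances ≠ []

/-- The time of an iteration: the overhead plus the time of all the instances. -/
def Iteration.time {P : ConicSDP} (it : Iteration P) : ℕ :=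
  it.overheadTime + (it.instances.map fun s => s.run.time).sum

/-- The memory of an iteration: the overhead plus the largest memory needed by an instance (memory
is reused from one instance to the next). -/
def Iteration.mem {P : ConicSDP} (it : Iteration P) : ℕ :=
  it.overheadMem + (it.instances.map fun s => s.run.mem).foldr max 0

/-- A general-purpose solver: on every problem and accuracy it performs one or more iterations and
outputs a pair `(x, y)`; on standard-form problems the output is `ε`-accurate after
`O(√n log(1/ε))` iterations (for fixed problem data, as `ε → 0`), and each iteration solves `O(1)`
Schur complement equations with `O(ω² n)` time and `O(ω n)` memory overhead. -/
structure GeneralPurposeSolver where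
  iterations : (ε : ℝ) → (P : ConicSDP) → List (Iteration P)
  x : (ε : ℝ) → (P : ConicSDP) → P.Col → ℝ
  y : (ε : ℝ) → (P : ConicSDP) → Fin P.p → ℝ
  iterations_ne : ∀ ε P, iterations ε P ≠ []
  accurate : ∀ (ε : ℝ) (P : ConicSDP), 0 < ε → P.IsStandardForm →
    P.InCone (x ε P) ∧
    ‖WithLp.toLp 2 (P.A.mulVec (x ε P) - P.b)‖ ≤ ε ∧
    P.InCone (P.c - P.A.transpose.mulVec (y ε P) + ε • P.oneK) ∧
    P.c ⬝ᵥ x ε P - P.b ⬝ᵥ y ε P ≤ ε * P.totalOrder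
  iteration_count : ∀ P : ConicSDP, P.IsStandardForm → ∃ K : ℝ, ∀ ε : ℝ, 0 < ε → ε ≤ 1 / 2 →
    ((iterations ε P).length : ℝ) ≤ K * √(P.totalOrder) * Real.log (1 / ε)
  per_iteration : ∃ K : ℕ, ∀ (ε : ℝ) (P : ConicSDP), 0 < ε → P.IsStandardForm →
    ∀ it ∈ iterations ε P,
      it.overheadTime ≤ K * (P.maxOrder ^ 2 * P.totalOrder) ∧
      it.overheadMem ≤ K * (P.maxOrder * P.totalOrder) ∧
      it.instances.length ≤ K

/-! ## The chordal conversion algorithm -/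

/-- The conic program of chordal conversion: with `F = chol(E)` and `J_j = col_F(j)`,
`max ⟨-C, Y⟩` subject to `bᵢ - ⟨Aᵢ, Y⟩ ≥ 0` for all `i` and `Y[J_j, J_j] ⪰ 0` for all `j`, over
matrices `Y` with pattern `F`, as an instance of `max {𝐛ᵀy : 𝐜 - 𝐀ᵀy ∈ 𝒦}`, `y = svec_F(Y)`. -/
def convertedSDP {n m : ℕ} (C : Matrix (Fin n) (Fin n) ℝ) (A : Fin m → Matrix (Fin n) (Fin n) ℝ)
    (b : Fin m → ℝ) : ConicSDP where
  ι := Fin m ⊕ Fin n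
  fintypeι := inferInstance
  decEqι := inferInstance
  ord := Sum.elim (fun _ => 1) (fun j => (col (symbChol (aggPattern C A)) j).card)
  p := rasterCard (symbChol (aggPattern C A))
  A := Matrix.of fun α u => match u with
    | ⟨Sum.inl i, _⟩ => svecF (symbChol (aggPattern C A)) (A i) α
    | ⟨Sum.inr j, v⟩ => - svec (principal (col (symbChol (aggPattern C A)) j)
        (symUnit (entry (symbChol (aggPattern C A)) α))) v
  b := fun α => - svecF (symbChol (aggPattern C A)) C α
  c := fun u => match u with
    | ⟨Sum.inl i, _⟩ => b i
    | ⟨Sum.inr _, _⟩ => 0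

/-- The reordered matrix `Π X Πᵀ`, where `Π` is the permutation matrix with
`(Π X Πᵀ) i j = X (π i) (π j)`. -/
def reorder {n : ℕ} (π : Equiv.Perm (Fin n)) (X : Matrix (Fin n) (Fin n) ℝ) :
    Matrix (Fin n) (Fin n) ℝ := X.submatrix π π

section Algorithm

variable {n m : ℕ} (S : GeneralPurposeSolver) (ε : ℝ) (C : Matrix (Fin n) (Fin n) ℝ)
  (A : Fin m → Matrix (Fin n) (Fin n) ℝ) (b : Fin m → ℝ) (π : Equiv.Perm (Fin n))

/-- The aggregate sparsity pattern of the reordered data. -/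
def reorderedPattern : Pattern n := aggPattern (reorder π C) (fun i => reorder π (A i))

/-- The conic program passed to the solver. -/
def algSDP : ConicSDP := convertedSDP (reorder π C) (fun i => reorder π (A i)) b

/-- The column sets `J_j` of the symbolic Cholesky factor. -/
def algCol (j : Fin n) : Finset (Fin n) := col (symbChol (reorderedPattern C A π)) j

/-- The matrix `Y` recovered from the output of the solver. -/
def algY : Matrix (Fin n) (Fin n) ℝ :=
  smatF (symbChol (reorderedPattern C A π)) (S.y ε (algSDP C A b π))

/-- An execution of the algorithm on accuracy `ε`, data `C, A, b` and permutation `π`, with solver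
`S`. The costs of the first step (reordering and symbolic factorization) and of the last step
(recovery and positive semidefinite completion) may be any natural numbers, depending on how these
steps are implemented. The last step computes `δ = - min_j {0, λ_min(Y[J_j, J_j])}` and some
`Ũ` with `(Ũ Ũᵀ)[J_j, J_j] = Y[J_j, J_j] + δ I` for all `j`. -/
structure Execution where
  firstTime : ℕ
  firstMem : ℕ
  lastTime : ℕ
  lastMem : ℕ
  δ : ℝ
  isLeast_δ : IsLeast {d : ℝ | 0 ≤ d ∧
    ∀ j, (principal (algCol C A π j) (algY S ε C A b π) + d • 1).PosSemidef} δ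
  Utilde : Matrix (Fin n) (Fin (frontsize (reorderedPattern C A π))) ℝ
  completion : ∀ j, principal (algCol C A π j) (Utilde * Utilde.transpose) =
    principal (algCol C A π j) (algY S ε C A b π) + δ • 1

variable {S ε C A b π}

/-- The output `U = Πᵀ Ũ`. -/
def Execution.U (e : Execution S ε C A b π) :
    Matrix (Fin n) (Fin (frontsize (reorderedPattern C A π))) ℝ :=
  e.Utilde.submatrix π.symm id

/-- The output `v = -(x_i)_{i ≤ m}`. -/
def Execution.v (_e : Execution S ε C A b π) (i : Fin m) : ℝ :=
  - S.x ε (algSDP C A b π) ⟨Sum.inl i, ⟨((0 : Fin 1), (0 : Fin 1)), le_refl (0 : Fin 1)⟩⟩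

/-- The iterations of the interior-point method in the execution. -/
def Execution.iterations (_e : Execution S ε C A b π) : List (Iteration (algSDP C A b π)) :=
  S.iterations ε (algSDP C A b π)

/-- The total time of the execution. -/
def Execution.time (e : Execution S ε C A b π) : ℕ :=
  e.firstTime + (e.iterations.map fun it => it.time).sum + e.lastTime

/-- The peak memory of the execution. -/
def Execution.mem (e : Execution S ε C A b π) : ℕ :=
  max e.firstMem (max ((e.iterations.map fun it => it.mem).foldr max 0) e.lastMem)

end Algorithm

/-- Strong duality is attained for the semidefinite program with data `C, A, b`: there are feasible
`X ⪰ 0` and `v ≤ 0` with the same objective. -/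
def StrongDualityAttained {n m : ℕ} (C : Matrix (Fin n) (Fin n) ℝ)
    (A : Fin m → Matrix (Fin n) (Fin n) ℝ) (b : Fin m → ℝ) : Prop :=
  ∃ (X : Matrix (Fin n) (Fin n) ℝ) (v : Fin m → ℝ), X.PosSemidef ∧ (∀ i, v i ≤ 0) ∧
    (∀ i, (A i * X).trace ≤ b i) ∧ (C - ∑ i, v i • A i).PosSemidef ∧
    (C * X).trace = b ⬝ᵥ v

end ChordalConv

end

open ChordalConv

namespace ChordalConv

/-! ## Symbolic Cholesky factorization -/

/-! The cost is forced by one dense block of the Schur complement. Let `ω` be the frontsize of the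
reordered data pattern, attained at a column set `J`. The positions of the lower triangle of `J × J`
all belong to the factor `F`, so they are coordinates of `y`, at least `ω² / 2` of them, and all of
them enter the semidefinite block of `J`. Hence they form a clique `K` in the aggregated Schur
pattern (`exists_schur_clique`, through `ConicSDP.mem_schurPattern`).

A clique stays a clique under every ordering, and symbolic factorization only adds entries
(`clique_permPattern`). Eliminating it costs at least `|K|³ / 6` operations (`clique_cube_le`), and
storing its factor takes at least `|K|² / 2` reals. This gives `ω⁶ / 48` time and `ω⁴ / 8` memory
for each solve. The terms `m + n` come from the `m + n` cones: forming the Schur matrix visits each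
of them, and the scaling point has a coordinate in each.

The link with treewidth is that, for `n > 0`, the elimination tree with the column sets as bags is a
tree decomposition, so that `tw(G) + 1 ≤ ω` for every permutation (`treewidth_succ_le_frontsize`).

For sharpness, a fully dense instance with `n = τ + 1` has a complete graph, whose treewidth is `n -
1` because some bag contains every vertex. There `N ≤ 2 (τ + 1)²` when `m ≤ (τ + 1)²`, so the sixth
and fourth powers already dominate the upper bounds. -/

theorem subset_cholStep {n : ℕ} (E : Pattern n) (k : Fin n) : E ⊆ cholStep E k := by
  intro e he
  simp [cholStep, he]

theorem subset_foldl_cholStep {n : ℕ} (l : List (Fin n)) (E : Pattern n) :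
    E ⊆ l.foldl cholStep E := by
  induction l generalizing E with
  | nil => exact Finset.Subset.refl _
  | cons k l ih => exact (subset_cholStep E k).trans (ih _)

theorem subset_symbChol {n : ℕ} (E : Pattern n) : E ⊆ symbChol E :=
  subset_foldl_cholStep _ _

/-- Eliminating indices that are at least `j` does not change column `j` below the diagonal. -/
theorem mem_of_mem_foldl_cholStep {n : ℕ} (l : List (Fin n)) (E : Pattern n) {i j : Fin n}
    (hij : j < i) (hl : ∀ k ∈ l, j ≤ k) (h : (i, j) ∈ l.foldl cholStep E) : (i, j) ∈ E := by
  induction l generalizing E with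
  | nil => exact h
  | cons k l ih =>
    have h1 := ih (cholStep E k) (fun x hx => hl x (List.mem_cons_of_mem _ hx)) h
    have hk := hl k List.mem_cons_self
    simp only [cholStep, Finset.mem_union, Finset.mem_singleton, Finset.mem_filter,
      Finset.mem_univ, true_and, Prod.mk.injEq] at h1
    rcases h1 with (h1 | ⟨rfl, rfl⟩) | h1
    · exact h1
    · exact absurd hij (lt_irrefl _)
    · exact absurd hk (not_le.2 h1.2.2.2)

theorem finRange_eq_append {n : ℕ} (j : Fin n) :
    ∃ l₁ l₂ : List (Fin n), List.finRange n = l₁ ++ j :: l₂ ∧ ∀ k ∈ l₂, j ≤ k := by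
  obtain ⟨l₁, l₂, h⟩ := List.append_of_mem (List.mem_finRange j)
  refine ⟨l₁, l₂, h, fun k hk => ?_⟩
  have hp : (List.finRange n).Pairwise (· < ·) := List.pairwise_lt_finRange n
  rw [h, List.pairwise_append] at hp
  exact ((List.pairwise_cons.1 hp.2.1).1 k hk).le

theorem diag_mem_symbChol {n : ℕ} (E : Pattern n) (j : Fin n) : (j, j) ∈ symbChol E := by
  obtain ⟨l₁, l₂, h, -⟩ := finRange_eq_append j
  rw [symbChol, h, List.foldl_append, List.foldl_cons]
  apply subset_foldl_cholStep
  simp [cholStep]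

/-- The subdiagonal part of column `j` is already final when `j` is eliminated. That step therefore
sees both entries and creates `(i, k)`, and later steps never delete anything. -/
theorem fill_mem_symbChol {n : ℕ} (E : Pattern n) {i j k : Fin n} (hjk : j < k) (hki : k < i)
    (hi : (i, j) ∈ symbChol E) (hk : (k, j) ∈ symbChol E) : (i, k) ∈ symbChol E := by
  obtain ⟨l₁, l₂, h, hl⟩ := finRange_eq_append j
  have hl' : ∀ x ∈ j :: l₂, j ≤ x := by
    intro x hx
    rcases List.mem_cons.1 hx with rfl | hx
    · exact le_rfl
    · exact hl x hx
  rw [symbChol, h, List.foldl_append] at hi hk ⊢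
  have hi' := mem_of_mem_foldl_cholStep _ _ (hjk.trans hki) hl' hi
  have hk' := mem_of_mem_foldl_cholStep _ _ hjk hl' hk
  rw [List.foldl_cons]
  apply subset_foldl_cholStep
  simp [cholStep, hi', hk', hki, hjk]

/-- The column sets of the symbolic Cholesky factor are cliques. -/
theorem cliquePattern_col_subset {n : ℕ} (E : Pattern n) (j : Fin n) :
    cliquePattern (col (symbChol E) j) ⊆ symbChol E := by
  rintro ⟨a, b⟩ h
  simp only [cliquePattern, col, below, Finset.mem_filter, Finset.mem_product, Finset.mem_insert,
    Finset.mem_univ, true_and] at h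
  obtain ⟨⟨ha, hb⟩, hba⟩ := h
  rcases eq_or_lt_of_le hba with rfl | hba
  · exact diag_mem_symbChol E _
  · rcases ha with rfl | ha
    · rcases hb with rfl | hb
      · exact absurd hba (lt_irrefl _)
      · exact absurd hba hb.1.not_gt
    · rcases hb with rfl | hb
      · exact ha.2
      · exact fill_mem_symbChol E hb.1 hba ha.2 hb.2

/-! ## Counting -/

theorem card_sq_le_two_mul_cliquePattern {n : ℕ} (K : Finset (Fin n)) :
    K.card ^ 2 ≤ 2 * (cliquePattern K).card := by
  have h : K ×ˢ K ⊆ cliquePattern K ∪ (cliquePattern K).image Prod.swap := by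
    rintro ⟨a, b⟩ hab
    rw [Finset.mem_product] at hab
    rcases le_total b a with h | h
    · exact Finset.mem_union_left _ (by simp [cliquePattern, h, hab.1, hab.2])
    · refine Finset.mem_union_right _ (Finset.mem_image.2 ⟨(b, a), ?_, rfl⟩)
      simp [cliquePattern, h, hab.1, hab.2]
  calc K.card ^ 2 = (K ×ˢ K).card := by rw [Finset.card_product, sq]
    _ ≤ _ := Finset.card_le_card h
    _ ≤ _ := Finset.card_union_le _ _
    _ ≤ (cliquePattern K).card + (cliquePattern K).card :=
        Nat.add_le_add_left Finset.card_image_le _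
    _ = _ := by ring

/-- The number of operations that eliminate column `j`. -/
def colCost {p : ℕ} (F : Pattern p) (j : Fin p) : ℕ :=
  1 + (below F j).card + (updatePairs F j).card

/-- With `d` entries below the diagonal, the rank-one update alone costs at least `d² / 2`; the
square root and the divisions supply the `2 d + 1` that completes the square. -/
theorem sq_le_two_mul_colCost {p : ℕ} (F : Pattern p) (j : Fin p) (K : Finset (Fin p))
    (hK : K ⊆ below F j) : (K.card + 1) ^ 2 ≤ 2 * colCost F j := by
  have h1 := Finset.card_le_card hK
  have h2 : (below F j).card ^ 2 ≤ 2 * (updatePairs F j).card :=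
    card_sq_le_two_mul_cliquePattern _
  have h3 : K.card ^ 2 ≤ (below F j).card ^ 2 := Nat.pow_le_pow_left h1 2
  unfold colCost
  nlinarith

/-- The smallest index of a clique has all the others below it in its column. Removing smallest
indices one at a time compares a sum of squares with a cube. -/
theorem clique_cube_le {p : ℕ} (F : Pattern p) (K : Finset (Fin p)) (hK : cliquePattern K ⊆ F) :
    K.card ^ 3 ≤ 6 * ∑ j ∈ K, colCost F j := by
  induction K using Finset.induction_on_min with
  | empty => simp
  | insert a K ha ih =>
    have haK : a ∉ K := fun h => lt_irrefl _ (ha a h)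
    have hmem : ∀ x y, x ∈ insert a K → y ∈ insert a K → y ≤ x → (x, y) ∈ F := by
      intro x y hx hy hxy
      apply hK
      simp only [cliquePattern, Finset.mem_filter, Finset.mem_product]
      exact ⟨⟨hx, hy⟩, hxy⟩
    have h1 := ih (by
      rintro ⟨x, y⟩ h
      simp only [cliquePattern, Finset.mem_filter, Finset.mem_product] at h
      exact hmem x y (Finset.mem_insert_of_mem h.1.1) (Finset.mem_insert_of_mem h.1.2) h.2)
    have h2 := sq_le_two_mul_colCost F a K (by
      intro x hx
      simp only [below, Finset.mem_filter, Finset.mem_univ, true_and]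
      exact ⟨ha x hx, hmem x a (Finset.mem_insert_of_mem hx) (Finset.mem_insert_self _ _)
        (ha x hx).le⟩)
    -- The increment of the cube is at most three squares, and each square is at most twice a column
    -- cost: hence the factor `6`.
    have h3 : (K.card + 1) ^ 3 ≤ K.card ^ 3 + 3 * (K.card + 1) ^ 2 := by
      ring_nf
      omega
    rw [Finset.card_insert_of_notMem haK, Finset.sum_insert haK]
    omega

/-! ## Costs of programs -/

namespace Prog

theorem time_bind {α β : Type} (x : Prog α) (f : α → Prog β) :
    (x >>= f).time = x.time + (f x.val).time := rfl

theorem mem_bind {α β : Type} (x : Prog α) (f : α → Prog β) :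
    (x >>= f).mem = x.mem + (f x.val).mem := rfl

/-- Time adds up along binds. Because the bound on a single step is uniform in the running state,
the numerical values never have to be followed. -/
theorem sum_le_time_foldlM {α β : Type} (f : β → α → Prog β) (g : α → ℕ)
    (h : ∀ b a, g a ≤ (f b a).time) (l : List α) (b : β) :
    (l.map g).sum ≤ (l.foldlM f b).time := by
  induction l generalizing b with
  | nil => exact Nat.zero_le _
  | cons a l ih =>
    rw [List.foldlM_cons, time_bind, List.map_cons, List.sum_cons]
    exact Nat.add_le_add (h b a) (ih _)

theorem length_le_time_foldlM {α β : Type} (f : β → α → Prog β)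
    (h : ∀ b a, 1 ≤ (f b a).time) (l : List α) (b : β) :
    l.length ≤ (l.foldlM f b).time := by
  have := sum_le_time_foldlM f (fun _ => 1) h l b
  simpa using this

end Prog

theorem card_le_time_formSchur (P : ConicSDP) (w : P.ScalingPoint) (hord : ∀ k, 1 ≤ P.ord k) :
    Fintype.card P.ι ≤ (formSchur P w).time := by
  unfold formSchur
  rw [← Finset.card_univ, ← Finset.length_toList]
  refine Prog.length_le_time_foldlM _ (fun H k => ?_) _ _
  refine le_trans ?_ (Prog.length_le_time_foldlM _ (fun H uv => ?_) _ _)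
  · have i0 : LowerIdx (P.ord k) := ⟨(⟨0, hord k⟩, ⟨0, hord k⟩), le_rfl⟩
    rw [Finset.length_toList]
    exact Finset.card_pos.2 ⟨(i0, i0), Finset.mem_univ _⟩
  · rw [Prog.time_bind]
    exact Nat.le_add_right 1 _

theorem sum_colCost_le_time_sparseChol {p : ℕ} (F : Pattern p) (S : Store p) :
    ∑ j, colCost F j ≤ (sparseChol F S).time := by
  unfold sparseChol
  rw [Prog.time_bind]
  refine le_trans ?_ (Nat.le_add_left _ _)
  have hs : ∑ j, colCost F j = ((List.finRange p).map (colCost F)).sum := by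
    rw [← List.sum_toFinset _ (List.nodup_finRange p)]
    simp
  rw [hs]
  refine Prog.sum_le_time_foldlM _ _ (fun S j => ?_) _ _
  rw [Prog.time_bind, Prog.time_bind]
  have h1 : ∀ S : Store p, ∀ d : ℝ, (below F j).card ≤ ((below F j).toList.foldlM (fun S i => do
      let l ← op (S (i, j) / d)
      pure (Function.update S (i, j) l)) S : Prog (Store p)).time := by
    intro S d
    rw [← Finset.length_toList]
    exact Prog.length_le_time_foldlM _ (fun _ _ => le_rfl) _ _
  have h2 : ∀ S : Store p, (updatePairs F j).card ≤
      ((updatePairs F j).toList.foldlM (fun S e => do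
      let s ← op (S e - S (e.1, j) * S (e.2, j))
      pure (Function.update S e s)) S : Prog (Store p)).time := by
    intro S
    rw [← Finset.length_toList]
    exact Prog.length_le_time_foldlM _ (fun _ _ => le_rfl) _ _
  unfold colCost
  rw [add_assoc]
  exact Nat.add_le_add le_rfl (Nat.add_le_add (h1 _ _) (h2 _))

theorem card_le_mem_sparseChol {p : ℕ} (F : Pattern p) (S : Store p) :
    F.card ≤ (sparseChol F S).mem := by
  unfold sparseChol
  rw [Prog.mem_bind]
  exact Nat.le_add_right F.card _

/-- Only two stages are kept: forming the matrix, which visits every cone, and the factorization. -/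
theorem time_solveSchur_ge (P : ConicSDP) (σ : Equiv.Perm (Fin P.p)) (w : P.ScalingPoint)
    (r : Fin P.p → ℝ) (hord : ∀ k, 1 ≤ P.ord k) :
    Fintype.card P.ι + ∑ j, colCost (symbChol (permPattern σ P.schurPattern)) j ≤
      (solveSchur P σ w r).time := by
  unfold solveSchur
  simp only [Prog.time_bind]
  have h1 := card_le_time_formSchur P w hord
  have h2 := sum_colCost_le_time_sparseChol (symbChol (permPattern σ P.schurPattern))
    (fun e => (formSchur P w).val (max (σ e.1) (σ e.2), min (σ e.1) (σ e.2)))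
  omega

theorem mem_solveSchur_ge (P : ConicSDP) (σ : Equiv.Perm (Fin P.p)) (w : P.ScalingPoint)
    (r : Fin P.p → ℝ) :
    Fintype.card P.Col + (symbChol (permPattern σ P.schurPattern)).card ≤
      (solveSchur P σ w r).mem := by
  unfold solveSchur
  simp only [Prog.mem_bind]
  have h2 := card_le_mem_sparseChol (symbChol (permPattern σ P.schurPattern))
    (fun e => (formSchur P w).val (max (σ e.1) (σ e.2), min (σ e.1) (σ e.2)))
  have h3 : (alloc (P.nnzA + Fintype.card P.Col + P.p)).mem =
    P.nnzA + Fintype.card P.Col + P.p := rfl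
  omega

/-- A clique of the Schur complement pattern is, after reordering, a clique of its symbolic
Cholesky factor. -/
theorem clique_permPattern {p : ℕ} (E : Pattern p) (K : Finset (Fin p)) (hK : cliquePattern K ⊆ E)
    (σ : Equiv.Perm (Fin p)) :
    cliquePattern (K.map σ.symm.toEmbedding) ⊆ symbChol (permPattern σ E) := by
  refine Finset.Subset.trans ?_ (subset_symbChol _)
  rintro ⟨x, y⟩ h
  simp only [cliquePattern, Finset.mem_filter, Finset.mem_product, Finset.mem_map_equiv,
    Equiv.symm_symm] at h
  simp only [permPattern, Finset.mem_filter, Finset.mem_univ, true_and]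
  refine ⟨h.2, ?_⟩
  rcases le_total (σ y) (σ x) with hle | hle
  · left
    apply hK
    simp only [cliquePattern, Finset.mem_filter, Finset.mem_product]
    exact ⟨h.1, hle⟩
  · right
    apply hK
    simp only [cliquePattern, Finset.mem_filter, Finset.mem_product]
    exact ⟨h.1.symm, hle⟩

theorem run_time_ge (P : ConicSDP) (hord : ∀ k, 1 ≤ P.ord k) (s : SchurInstance P)
    (K : Finset (Fin P.p)) (hK : cliquePattern K ⊆ P.schurPattern) :
    6 * Fintype.card P.ι + K.card ^ 3 ≤ 6 * s.run.time := by
  have h1 := time_solveSchur_ge P s.σ s.w s.r hord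
  have h2 := clique_cube_le _ _ (clique_permPattern _ K hK s.σ)
  rw [Finset.card_map] at h2
  have h3 := Finset.sum_le_sum_of_subset (f := colCost (symbChol (permPattern s.σ P.schurPattern)))
    (Finset.subset_univ (K.map s.σ.symm.toEmbedding))
  unfold SchurInstance.run
  omega

theorem run_mem_ge (P : ConicSDP) (s : SchurInstance P)
    (K : Finset (Fin P.p)) (hK : cliquePattern K ⊆ P.schurPattern) :
    2 * Fintype.card P.Col + K.card ^ 2 ≤ 2 * s.run.mem := by
  have h1 := mem_solveSchur_ge P s.σ s.w s.r
  have h2 := card_sq_le_two_mul_cliquePattern (K.map s.σ.symm.toEmbedding)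
  rw [Finset.card_map] at h2
  have h3 := Finset.card_le_card (clique_permPattern _ K hK s.σ)
  unfold SchurInstance.run
  omega

theorem card_ι_le_card_Col (P : ConicSDP) (hord : ∀ k, 1 ≤ P.ord k) :
    Fintype.card P.ι ≤ Fintype.card P.Col :=
  Fintype.card_le_of_injective
    (fun k => (⟨k, ⟨(⟨0, hord k⟩, ⟨0, hord k⟩), le_rfl⟩⟩ : P.Col))
    (fun _ _ h => congrArg Sigma.fst h)

theorem Iteration.time_ge {P : ConicSDP} (it : Iteration P) :
    ∃ s : SchurInstance P, s.run.time ≤ it.time := by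
  obtain ⟨s, hs⟩ := List.exists_mem_of_ne_nil _ it.instances_ne
  refine ⟨s, le_trans ?_ (Nat.le_add_left _ _)⟩
  exact List.single_le_sum (fun _ _ => Nat.zero_le _) _ (List.mem_map_of_mem hs)

theorem le_foldr_max {l : List ℕ} {a : ℕ} (h : a ∈ l) : a ≤ l.foldr max 0 := by
  induction l with
  | nil => simp at h
  | cons b l ih =>
    rw [List.foldr_cons]
    rcases List.mem_cons.1 h with rfl | h
    · exact le_max_left _ _
    · exact (ih h).trans (le_max_right _ _)

theorem Iteration.mem_ge {P : ConicSDP} (it : Iteration P) :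
    ∃ s : SchurInstance P, s.run.mem ≤ it.mem := by
  obtain ⟨s, hs⟩ := List.exists_mem_of_ne_nil _ it.instances_ne
  refine ⟨s, le_trans ?_ (Nat.le_add_left _ _)⟩
  exact le_foldr_max (List.mem_map_of_mem hs)

/-! ## Treewidth -/

theorem treewidth_le_width {V : Type} [DecidableEq V] {G : SimpleGraph V}
    (D : TreeDecomposition G) : treewidth G ≤ D.width :=
  Nat.sInf_le ⟨D, rfl⟩

/-- The graph on `0, …, N` that joins every index to its parent. -/
def parentGraph {N : ℕ} (par : Fin (N + 1) → Fin (N + 1)) : SimpleGraph (Fin (N + 1)) :=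
  SimpleGraph.fromRel fun i j => par i = j

theorem parentGraph_adj {N : ℕ} {par : Fin (N + 1) → Fin (N + 1)}
    (hpar : ∀ i, i ≠ Fin.last N → i < par i) {i : Fin (N + 1)} (hi : i ≠ Fin.last N) :
    (parentGraph par).Adj i (par i) := by
  rw [parentGraph, SimpleGraph.fromRel_adj]
  exact ⟨(hpar i hi).ne, Or.inl rfl⟩

/-- Climbing to parents reaches the last vertex, so the graph is connected. Every edge is `{i, par
i}` for some `i` other than the last vertex, so there are at most `N` edges on `N + 1` vertices. -/
theorem parentGraph_isTree {N : ℕ} {par : Fin (N + 1) → Fin (N + 1)}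
    (hpar : ∀ i, i ≠ Fin.last N → i < par i) (hlast : par (Fin.last N) = Fin.last N) :
    (parentGraph par).IsTree := by
  have hreach : ∀ d : ℕ, ∀ i : Fin (N + 1), N - (i : ℕ) ≤ d →
      (parentGraph par).Reachable i (Fin.last N) := by
    intro d
    induction d with
    | zero =>
      intro i hi
      have : i = Fin.last N := Fin.ext (by have := i.2; simp only [Fin.val_last]; omega)
      rw [this]
    | succ d ih =>
      intro i hi
      by_cases h : i = Fin.last N
      · rw [h]
      · have h1 : (i : ℕ) < par i := hpar i h
        exact (parentGraph_adj hpar h).reachable.trans (ih _ (by omega))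
  have hconn : (parentGraph par).Connected :=
    SimpleGraph.connected_iff_exists_forall_reachable _ |>.2
      ⟨Fin.last N, fun i => (hreach _ i le_rfl).symm⟩
  refine SimpleGraph.isTree_iff_connected_and_card.2 ⟨hconn, le_antisymm ?_ ?_⟩
  · have hsub : (parentGraph par).edgeSet ⊆
        ((Finset.univ.erase (Fin.last N)).image fun i => s(i, par i) : Finset _) := by
      intro e
      induction e using Sym2.ind with
      | _ x y =>
        intro h
        rw [SimpleGraph.mem_edgeSet, parentGraph, SimpleGraph.fromRel_adj] at h
        obtain ⟨hne, h | h⟩ := h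
        · rw [Finset.mem_coe, Finset.mem_image]
          refine ⟨x, Finset.mem_erase.2 ⟨?_, Finset.mem_univ _⟩, by rw [h]⟩
          rintro rfl
          exact hne (hlast.symm.trans h)
        · rw [Finset.mem_coe, Finset.mem_image]
          refine ⟨y, Finset.mem_erase.2 ⟨?_, Finset.mem_univ _⟩, by rw [h, Sym2.eq_swap]⟩
          rintro rfl
          exact hne (h.symm.trans hlast)
    have h1 := Set.ncard_le_ncard hsub (Finset.finite_toSet _)
    rw [Set.ncard_coe_finset] at h1
    have h2 : (Finset.univ.erase (Fin.last N)).card = N := by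
      rw [Finset.card_erase_of_mem (Finset.mem_univ _)]
      simp
    have h3 := h1.trans Finset.card_image_le
    rw [h2] at h3
    rw [Nat.card_coe_set_eq, Nat.card_eq_fintype_card, Fintype.card_fin]
    omega
  · exact hconn.card_vert_le_card_edgeSet_add_one

/-- In a forest, the vertices of the path between two vertices lie on every walk between them. -/
theorem support_path_subset {V : Type} [DecidableEq V] {T : SimpleGraph V} (hT : T.IsAcyclic)
    {s t : V} {p : T.Walk s t} (hp : p.IsPath) (q : T.Walk s t) : p.support ⊆ q.support := by
  have h := (hT.subsingleton_path s t).elim ⟨p, hp⟩ q.toPath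
  have h' : p = q.bypass := congrArg Subtype.val h
  rw [h']
  exact q.support_bypass_subset_support

/-- The elimination-tree parent: the smallest subdiagonal index of the column, if any. -/
def elimParent {N : ℕ} (F : Pattern (N + 1)) (j : Fin (N + 1)) : Fin (N + 1) :=
  if h : (below F j).Nonempty then (below F j).min' h else Fin.last N

theorem mem_below {n : ℕ} {F : Pattern n} {i j : Fin n} :
    i ∈ below F j ↔ j < i ∧ (i, j) ∈ F := by
  simp [below]

theorem mem_col {n : ℕ} {F : Pattern n} {i j : Fin n} :
    i ∈ col F j ↔ i = j ∨ j < i ∧ (i, j) ∈ F := by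
  simp [col, mem_below]

theorem lt_elimParent {N : ℕ} (F : Pattern (N + 1)) (j : Fin (N + 1)) (hj : j ≠ Fin.last N) :
    j < elimParent F j := by
  unfold elimParent
  split_ifs with h
  · exact (mem_below.1 (Finset.min'_mem _ h)).1
  -- An index whose column has nothing below the diagonal is attached to the last vertex; this
  -- default turns the elimination forest into a single tree.
  · exact Fin.lt_last_iff_ne_last.2 hj

theorem elimParent_last {N : ℕ} (F : Pattern (N + 1)) :
    elimParent F (Fin.last N) = Fin.last N := by
  unfold elimParent
  split_ifs with h
  · exact absurd (mem_below.1 (Finset.min'_mem _ h)).1 (Fin.le_last _).not_gt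
  · rfl

/-- The nodes of the elimination tree whose column contains `v` form a subtree rooted at `v`. -/
theorem exists_walk_elimTree {N : ℕ} (E : Pattern (N + 1)) (v : Fin (N + 1)) :
    ∀ d : ℕ, ∀ s : Fin (N + 1), (v : ℕ) - s ≤ d → v ∈ col (symbChol E) s →
      ∃ q : (parentGraph (elimParent (symbChol E))).Walk s v,
        ∀ r ∈ q.support, v ∈ col (symbChol E) r := by
  intro d
  induction d with
  | zero =>
    intro s hd hs
    rcases mem_col.1 hs with rfl | h
    · exact ⟨SimpleGraph.Walk.nil, by simp [mem_col]⟩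
    · have h1 : (s : ℕ) < v := h.1
      omega
  | succ d ih =>
    intro s hd hs
    rcases mem_col.1 hs with rfl | h
    · exact ⟨SimpleGraph.Walk.nil, by simp [mem_col]⟩
    · have hvb : v ∈ below (symbChol E) s := mem_below.2 h
      have hne : (below (symbChol E) s).Nonempty := ⟨v, hvb⟩
      have hpar : elimParent (symbChol E) s = (below (symbChol E) s).min' hne := by
        rw [elimParent, dif_pos hne]
      have hmem := Finset.min'_mem _ hne
      have hle := Finset.min'_le _ _ hvb
      rw [← hpar] at hmem hle
      have hmem' := mem_below.1 hmem
      have hs' : s ≠ Fin.last N := fun hh => (Fin.le_last v).not_gt (hh ▸ h.1)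
      -- Both `v` and the parent of `s` lie below `s` in its column, and the parent is the smaller
      -- or equal one. The fill rule then puts `v` in the column of the parent, so the climb towards
      -- `v` never leaves the columns containing `v`.
      have hcol : v ∈ col (symbChol E) (elimParent (symbChol E) s) := by
        rcases hle.eq_or_lt with h' | h'
        · exact mem_col.2 (Or.inl h'.symm)
        · exact mem_col.2 (Or.inr ⟨h', fill_mem_symbChol E hmem'.1 h' h.2 hmem'.2⟩)
      have h1 : (s : ℕ) < elimParent (symbChol E) s := hmem'.1
      have h2 : (s : ℕ) < v := h.1
      obtain ⟨q, hq⟩ := ih _ (by omega) hcol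
      refine ⟨SimpleGraph.Walk.cons (parentGraph_adj (lt_elimParent _) hs') q, ?_⟩
      intro r hr
      rw [SimpleGraph.Walk.support_cons, List.mem_cons] at hr
      rcases hr with rfl | hr
      · exact hs
      · exact hq r hr

/-- The tree decomposition given by the elimination tree of a reordering of the graph. -/
def elimTreeDecomposition {N : ℕ} (G : SimpleGraph (Fin (N + 1))) (E : Pattern (N + 1))
    (π : Equiv.Perm (Fin (N + 1)))
    (hadj : ∀ i j, j < i → G.Adj (π i) (π j) → (i, j) ∈ E) : TreeDecomposition G where
  k := N + 1
  tree := parentGraph (elimParent (symbChol E))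
  isTree := parentGraph_isTree (lt_elimParent _) (elimParent_last _)
  bag t := (col (symbChol E) t).map π.toEmbedding
  vertexCover v := ⟨π.symm v, by rw [Finset.mem_map_equiv]; exact mem_col.2 (Or.inl rfl)⟩
  edgeCover u v h := by
    have h' : ∀ u v, G.Adj u v → π.symm v < π.symm u →
        π.symm u ∈ col (symbChol E) (π.symm v) ∧ π.symm v ∈ col (symbChol E) (π.symm v) := by
      intro u v huv hlt
      refine ⟨mem_col.2 (Or.inr ⟨hlt, ?_⟩), mem_col.2 (Or.inl rfl)⟩
      exact subset_symbChol E (hadj _ _ hlt (by simpa using huv))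
    simp only [Finset.mem_map_equiv]
    rcases lt_trichotomy (π.symm u) (π.symm v) with hlt | heq | hlt
    · exact ⟨π.symm u, (h' v u h.symm hlt).symm⟩
    · exact absurd (π.symm.injective heq) h.ne
    · exact ⟨π.symm v, h' u v h hlt⟩
  runningIntersection s t p hp r hr v hv := by
    rw [Finset.mem_inter, Finset.mem_map_equiv, Finset.mem_map_equiv] at hv
    rw [Finset.mem_map_equiv]
    obtain ⟨q₁, hq₁⟩ := exists_walk_elimTree E (π.symm v) _ s le_rfl hv.1
    obtain ⟨q₂, hq₂⟩ := exists_walk_elimTree E (π.symm v) _ t le_rfl hv.2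
    -- Both walks climb to the node of the common vertex `v` through bags containing `v`. Joined
    -- there, they form a walk from `s` to `t`, which must pass through every node of the tree path.
    have h := support_path_subset
      (parentGraph_isTree (lt_elimParent _) (elimParent_last _)).isAcyclic hp
      (q₁.append q₂.reverse) hr
    rw [SimpleGraph.Walk.mem_support_append_iff, SimpleGraph.Walk.support_reverse,
      List.mem_reverse] at h
    exact h.elim (hq₁ r) (hq₂ r)

/-- The treewidth is less than the frontsize of every reordering. -/
theorem treewidth_succ_le_frontsize {n : ℕ} (hn : 0 < n) (G : SimpleGraph (Fin n)) (E : Pattern n)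
    (π : Equiv.Perm (Fin n)) (hadj : ∀ i j, j < i → G.Adj (π i) (π j) → (i, j) ∈ E) :
    treewidth G + 1 ≤ frontsize E := by
  obtain ⟨N, rfl⟩ : ∃ N, n = N + 1 := ⟨n - 1, by omega⟩
  have h1 := treewidth_le_width (elimTreeDecomposition G E π hadj)
  have h2 : (elimTreeDecomposition G E π hadj).width = frontsize E - 1 := by
    simp only [TreeDecomposition.width, elimTreeDecomposition, frontsize, Finset.card_map]
    rfl
  -- Positivity of the frontsize makes the truncated subtraction in the width an honest one.
  have h3 : 1 ≤ frontsize E :=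
    le_trans (Finset.card_pos.2 ⟨0, mem_col.2 (Or.inl rfl)⟩)
      (Finset.le_sup (f := fun j => (col (symbChol E) j).card) (Finset.mem_univ 0))
  omega

theorem treewidth_of_isEmpty (G : SimpleGraph (Fin 0)) : treewidth G = 0 := by
  have h := treewidth_le_width (G := G)
    { k := 1
      tree := ⊥
      isTree := SimpleGraph.IsTree.of_subsingleton
      bag := fun _ => ∅
      vertexCover := fun v => v.elim0
      edgeCover := fun u => u.elim0
      runningIntersection := fun _ _ _ _ _ _ => by simp }
  simpa [TreeDecomposition.width] using h

theorem frontsize_le {n : ℕ} (E : Pattern n) : frontsize E ≤ n :=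
  Finset.sup_le fun _ _ => (Finset.card_le_univ _).trans (Fintype.card_fin n).le

theorem TreeDecomposition.mem_bag_of_mem_support {V : Type} [DecidableEq V] {G : SimpleGraph V}
    (D : TreeDecomposition G) {s t r : Fin D.k} (p : D.tree.Walk s t) (hp : p.IsPath) {v : V}
    (hs : v ∈ D.bag s) (ht : v ∈ D.bag t) (hr : r ∈ p.support) : v ∈ D.bag r :=
  D.runningIntersection s t p hp r hr (Finset.mem_inter.2 ⟨hs, ht⟩)

/-- Some bag of a tree decomposition of a complete graph contains every vertex. -/
theorem TreeDecomposition.exists_bag_eq_univ {V : Type} [DecidableEq V] [Fintype V]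
    (D : TreeDecomposition (⊤ : SimpleGraph V)) : ∃ t, D.bag t = Finset.univ := by
  have : Nonempty (Fin D.k) := D.isTree.connected.nonempty
  obtain ⟨t, ht⟩ := Finite.exists_max fun t => (D.bag t).card
  refine ⟨t, Finset.eq_univ_of_forall fun v => ?_⟩
  by_contra hv
  obtain ⟨s₀, hs₀⟩ := D.vertexCover v
  -- Let `t` have a bag of maximal size and suppose that it misses `v`. The nearest node `s` to `t`
  -- whose bag contains `v` turns out to have a bag containing `v` and all of `D.bag t`,
  -- contradicting maximality.
  obtain ⟨s, hs, hmin⟩ := (Finset.univ.filter fun s => v ∈ D.bag s).exists_min_image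
    (fun s => D.tree.dist t s) ⟨s₀, by simpa using hs₀⟩
  simp only [Finset.mem_filter, Finset.mem_univ, true_and] at hs hmin
  have hsub : insert v (D.bag t) ⊆ D.bag s := by
    intro u hu
    rcases Finset.mem_insert.1 hu with rfl | hu
    · exact hs
    obtain ⟨r, hur, hvr⟩ := D.edgeCover u v (fun h => hv (h ▸ hu))
    obtain ⟨p, hp, hlen⟩ := D.isTree.connected.exists_path_of_dist t s
    obtain ⟨q, hq, -⟩ := D.isTree.connected.exists_path_of_dist s r
    -- All bags along `q` contain `v`, so a common node other than `s` would be closer to `t` than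
    -- `s`. Thus `p` followed by `q` is a path from `t` to `r`; both of its end bags contain `u`,
    -- and hence so does the bag of `s`.
    have hdisj : ∀ x ∈ p.support, x ∈ q.support → x = s := by
      intro x hxp hxq
      by_contra hxs
      have h1 := hmin x (D.mem_bag_of_mem_support q hq hs hvr hxq)
      have h2 := SimpleGraph.dist_le (p.takeUntil x hxp)
      have h3 := p.length_takeUntil_lt_length hxp hxs
      omega
    have hpath : (p.append q).IsPath := by
      rw [SimpleGraph.Walk.isPath_def, SimpleGraph.Walk.support_append]
      refine List.nodup_append'.2 ⟨hp.support_nodup, hq.support_nodup.tail, ?_⟩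
      intro x hxp hxq
      have hx := hdisj x hxp (List.mem_of_mem_tail hxq)
      have hq' := hq.support_nodup
      rw [← SimpleGraph.Walk.cons_tail_support, List.nodup_cons] at hq'
      exact hq'.1 (hx ▸ hxq)
    exact D.mem_bag_of_mem_support _ hpath hu hur
      (SimpleGraph.Walk.mem_support_append_iff _ _ |>.2 (Or.inl p.end_mem_support))
  have h1 := Finset.card_le_card hsub
  rw [Finset.card_insert_of_notMem hv] at h1
  have h2 := ht s
  omega

theorem le_treewidth_top (n : ℕ) : n ≤ treewidth (⊤ : SimpleGraph (Fin (n + 1))) := by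
  have hne : (Set.range fun D : TreeDecomposition (⊤ : SimpleGraph (Fin (n + 1))) =>
      D.width).Nonempty :=
    ⟨_, elimTreeDecomposition ⊤ Finset.univ 1 (fun _ _ _ _ => Finset.mem_univ _), rfl⟩
  refine le_csInf hne ?_
  rintro _ ⟨D, rfl⟩
  obtain ⟨t, ht⟩ := D.exists_bag_eq_univ
  have h := Finset.le_sup (f := fun t => (D.bag t).card) (Finset.mem_univ t)
  simp only [ht, Finset.card_univ, Fintype.card_fin] at h
  simp only [TreeDecomposition.width]
  omega

theorem treewidth_top (n : ℕ) : treewidth (⊤ : SimpleGraph (Fin (n + 1))) = n := by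
  refine le_antisymm ?_ (le_treewidth_top n)
  have h1 := treewidth_succ_le_frontsize n.succ_pos (⊤ : SimpleGraph (Fin (n + 1))) Finset.univ 1
    (fun _ _ _ _ => Finset.mem_univ _)
  have h2 := frontsize_le (Finset.univ : Pattern (n + 1))
  omega

/-! ## The Schur complement pattern -/

/-- A positive definite matrix with positive entries. -/
def onePlusOnes (k : ℕ) : Matrix (Fin k) (Fin k) ℝ := 1 + Matrix.of fun _ _ => 1

theorem ones_posSemidef (k : ℕ) :
    (Matrix.of fun _ _ => 1 : Matrix (Fin k) (Fin k) ℝ).PosSemidef := by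
  have h : (Matrix.of fun _ _ => 1 : Matrix (Fin k) (Fin k) ℝ) =
      Matrix.vecMulVec (fun _ => 1) (star fun _ => 1) := by
    ext i j
    simp [Matrix.vecMulVec_apply]
  rw [h]
  exact Matrix.posSemidef_vecMulVec_self_star _

theorem onePlusOnes_posDef (k : ℕ) : (onePlusOnes k).PosDef :=
  Matrix.PosDef.one.add_posSemidef (ones_posSemidef k)

theorem onePlusOnes_pos {k : ℕ} (i j : Fin k) : 0 < onePlusOnes k i j := by
  unfold onePlusOnes
  rw [Matrix.add_apply, Matrix.of_apply, Matrix.one_apply]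
  split_ifs <;> norm_num

theorem symUnit_nonneg {n : ℕ} (e : Fin n × Fin n) (i j : Fin n) : 0 ≤ symUnit e i j := by
  have h : ∀ a b : Fin n, (0 : ℝ) ≤ Matrix.single a b (1 : ℝ) i j := by
    intro a b
    rw [Matrix.single_apply]
    split_ifs <;> norm_num
  unfold symUnit
  split_ifs
  · exact h _ _
  · rw [Matrix.smul_apply, Matrix.add_apply, smul_eq_mul]
    exact mul_nonneg (inv_nonneg.2 (Real.sqrt_nonneg _)) (add_nonneg (h _ _) (h _ _))

theorem symUnit_pos {n : ℕ} (e : Fin n × Fin n) : 0 < symUnit e e.1 e.2 := by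
  unfold symUnit
  split_ifs with h
  · simp [h]
  · rw [Matrix.smul_apply, Matrix.add_apply, smul_eq_mul]
    refine mul_pos (inv_pos.2 (Real.sqrt_pos.2 two_pos)) ?_
    simp [h]

theorem mul_apply_pos_of_nonneg {k : ℕ} {M V : Matrix (Fin k) (Fin k) ℝ}
    (hM : ∀ i j, 0 ≤ M i j) (hV : ∀ i j, 0 ≤ V i j) {i l j : Fin k} (h₁ : 0 < M i l)
    (h₂ : 0 < V l j) : 0 < (M * V) i j := by
  rw [Matrix.mul_apply]
  exact Finset.sum_pos' (fun x _ => mul_nonneg (hM _ _) (hV _ _))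
    ⟨l, Finset.mem_univ _, mul_pos h₁ h₂⟩

theorem mul_apply_nonneg {k : ℕ} {M V : Matrix (Fin k) (Fin k) ℝ}
    (hM : ∀ i j, 0 ≤ M i j) (hV : ∀ i j, 0 ≤ V i j) (i j : Fin k) : 0 ≤ (M * V) i j := by
  rw [Matrix.mul_apply]
  exact Finset.sum_nonneg fun x _ => mul_nonneg (hM _ _) (hV _ _)

/-- Where the inverse of `W` has positive entries, so has the Hessian. -/
theorem blockHess_pos {k : ℕ} (V : Matrix (Fin k) (Fin k) ℝ)
    (hpos : ∀ i j, 0 < V i j) (u v : LowerIdx k) :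
    0 < (symUnit u.1 * V * symUnit v.1 * V).trace := by
  have hV : ∀ i j, 0 ≤ V i j := fun i j => (hpos i j).le
  have h1 := fun e : Fin k × Fin k => mul_apply_nonneg (symUnit_nonneg e) hV
  have h2 := mul_apply_nonneg (h1 u.1) (symUnit_nonneg v.1)
  have h3 := mul_apply_nonneg h2 hV
  -- All terms of the trace are nonnegative. The closed walk that follows the position `u`, an entry
  -- of `V`, the position `v` and another entry of `V` back to the start contributes a positive
  -- product.
  refine Finset.sum_pos' (fun i _ => h3 i i) ⟨u.1.1, Finset.mem_univ _, ?_⟩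
  refine mul_apply_pos_of_nonneg h2 hV ?_ (hpos v.1.2 _)
  exact mul_apply_pos_of_nonneg (h1 u.1) (symUnit_nonneg v.1)
    (mul_apply_pos_of_nonneg (symUnit_nonneg u.1) hV (symUnit_pos u.1) (hpos _ v.1.1))
    (symUnit_pos v.1)

namespace ConicSDP

theorem schurMatrix_apply (P : ConicSDP) (w : P.ScalingPoint) (α β : Fin P.p) :
    P.schurMatrix w α β = ∑ k, ∑ u, ∑ v,
      P.A α ⟨k, u⟩ * blockHess (w.W k) u v * P.A β ⟨k, v⟩ := by
  have hrow : ∀ (k : P.ι) (v : LowerIdx (P.ord k)),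
      (P.A * Matrix.blockDiagonal' (fun k => blockHess (w.W k))) α ⟨k, v⟩ =
        ∑ u, P.A α ⟨k, u⟩ * blockHess (w.W k) u v := by
    intro k v
    rw [Matrix.mul_apply, Fintype.sum_sigma, Finset.sum_eq_single k]
    · exact Finset.sum_congr rfl fun u _ => by rw [Matrix.blockDiagonal'_apply_eq]
    · intro k' _ hk
      exact Finset.sum_eq_zero fun u _ => by
        rw [Matrix.blockDiagonal'_apply_ne _ _ _ hk, mul_zero]
    · exact fun h => absurd (Finset.mem_univ _) h
  rw [schurMatrix, Matrix.mul_apply, Fintype.sum_sigma]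
  refine Finset.sum_congr rfl fun k _ => ?_
  rw [Finset.sum_comm]
  refine Finset.sum_congr rfl fun v _ => ?_
  rw [hrow, Finset.sum_mul]
  rfl

/-- The scaling point whose block `k₀` is `t⁻¹ • (1 + 𝟏𝟏ᵀ)⁻¹`, and whose other blocks are
independent of `t`. -/
noncomputable def scaledPoint (P : ConicSDP) (k₀ : P.ι) (t : ℝ) (ht : 0 < t) : P.ScalingPoint where
  W k := ((if k = k₀ then t else 1) • onePlusOnes (P.ord k))⁻¹
  posDef k := by
    refine ((onePlusOnes_posDef _).smul ?_).inv
    split_ifs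
    exacts [ht, one_pos]

/-- The Hessian of `-log det` is quadratic in the inverse of the scaling point, so scaling one block
multiplies its contribution by `t²` and leaves the others fixed. -/
theorem blockHess_scaledPoint (P : ConicSDP) (k₀ : P.ι) (t : ℝ) (ht : 0 < t) (k : P.ι)
    (u v : LowerIdx (P.ord k)) :
    blockHess ((P.scaledPoint k₀ t ht).W k) u v = (if k = k₀ then t else 1) ^ 2 *
      (symUnit u.1 * onePlusOnes _ * symUnit v.1 * onePlusOnes _).trace := by
  have hpd : ((if k = k₀ then t else 1) • onePlusOnes (P.ord k)).PosDef := by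
    refine (onePlusOnes_posDef _).smul ?_
    split_ifs
    exacts [ht, one_pos]
  have hinv : ((P.scaledPoint k₀ t ht).W k)⁻¹ =
      (if k = k₀ then t else 1) • onePlusOnes (P.ord k) :=
    Matrix.nonsing_inv_nonsing_inv _ ((Matrix.isUnit_iff_isUnit_det _).1 hpd.isUnit)
  rw [blockHess, Matrix.of_apply, hinv]
  simp only [Matrix.mul_smul, Matrix.smul_mul, Matrix.trace_smul, smul_eq_mul]
  ring

/-- Two rows of the data matrix whose parts in some block are nonzero with nonpositive entries
interact in the Schur complement matrix. -/
theorem mem_schurPattern (P : ConicSDP) {α β : Fin P.p} (hβα : β ≤ α) (k₀ : P.ι)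
    (hα : ∀ u, P.A α ⟨k₀, u⟩ ≤ 0) (hβ : ∀ u, P.A β ⟨k₀, u⟩ ≤ 0)
    {u₀ v₀ : LowerIdx (P.ord k₀)} (hα₀ : P.A α ⟨k₀, u₀⟩ < 0) (hβ₀ : P.A β ⟨k₀, v₀⟩ < 0) :
    (α, β) ∈ P.schurPattern := by
  set T : P.ι → ℝ := fun k => ∑ u, ∑ v, P.A α ⟨k, u⟩ *
    (symUnit u.1 * onePlusOnes (P.ord k) * symUnit v.1 * onePlusOnes _).trace * P.A β ⟨k, v⟩ with hT
  have hTpos : 0 < T k₀ := by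
    have h0 : ∀ u v, 0 ≤ P.A α ⟨k₀, u⟩ *
        (symUnit u.1 * onePlusOnes (P.ord k₀) * symUnit v.1 * onePlusOnes _).trace *
        P.A β ⟨k₀, v⟩ := fun u v =>
      mul_nonneg_of_nonpos_of_nonpos
        (mul_nonpos_of_nonpos_of_nonneg (hα u) (blockHess_pos _ onePlusOnes_pos u v).le) (hβ v)
    refine Finset.sum_pos' (fun u _ => Finset.sum_nonneg fun v _ => h0 u v)
      ⟨u₀, Finset.mem_univ _, Finset.sum_pos' (fun v _ => h0 u₀ v) ⟨v₀, Finset.mem_univ _, ?_⟩⟩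
    exact mul_pos_of_neg_of_neg
      (mul_neg_of_neg_of_pos hα₀ (blockHess_pos _ onePlusOnes_pos u₀ v₀)) hβ₀
  -- The other blocks may contribute with either sign and cancel block `k₀` at one scaling point.
  -- Since `T k₀ > 0`, the entry is strictly increasing in `t > 0`, so it cannot vanish at both `t =
  -- 1` and `t = 2`.
  have hH : ∀ t (ht : 0 < t), P.schurMatrix (P.scaledPoint k₀ t ht) α β =
      t ^ 2 * T k₀ + ∑ k ∈ Finset.univ.erase k₀, T k := by
    intro t ht
    have hk : ∀ k, ∑ u, ∑ v, P.A α ⟨k, u⟩ * blockHess ((P.scaledPoint k₀ t ht).W k) u v *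
        P.A β ⟨k, v⟩ = (if k = k₀ then t else 1) ^ 2 * T k := by
      intro k
      simp only [hT, Finset.mul_sum, blockHess_scaledPoint]
      exact Finset.sum_congr rfl fun u _ => Finset.sum_congr rfl fun v _ => by ring
    rw [schurMatrix_apply, ← Finset.add_sum_erase _ _ (Finset.mem_univ k₀)]
    simp only [hk, if_true]
    congr 1
    refine Finset.sum_congr rfl fun k hk' => ?_
    rw [if_neg (Finset.ne_of_mem_erase hk')]
    ring
  simp only [schurPattern, Finset.mem_filter, Finset.mem_univ, true_and]
  refine ⟨hβα, ?_⟩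
  by_contra hcon
  simp only [not_exists, not_not] at hcon
  have h1 := hcon (P.scaledPoint k₀ 1 one_pos)
  have h2 := hcon (P.scaledPoint k₀ 2 two_pos)
  rw [hH] at h1 h2
  linarith

end ConicSDP

/-! ## The converted program -/

theorem svec_nonneg {k : ℕ} {X : Matrix (Fin k) (Fin k) ℝ} (hX : ∀ i j, 0 ≤ X i j)
    (u : LowerIdx k) : 0 ≤ svec X u := by
  unfold svec symCoord
  split_ifs
  · exact hX _ _
  · exact mul_nonneg (Real.sqrt_nonneg _) (hX _ _)

theorem svec_pos {k : ℕ} {X : Matrix (Fin k) (Fin k) ℝ} {u : LowerIdx k}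
    (h : 0 < X u.1.1 u.1.2) : 0 < svec X u := by
  unfold svec symCoord
  split_ifs
  · exact h
  · exact mul_pos (Real.sqrt_pos.2 two_pos) h

theorem exists_svec_principal_symUnit_pos {n : ℕ} (J : Finset (Fin n)) {e : Fin n × Fin n}
    (he : e ∈ cliquePattern J) : ∃ u, 0 < svec (principal J (symUnit e)) u := by
  simp only [cliquePattern, Finset.mem_filter, Finset.mem_product] at he
  obtain ⟨a, ha⟩ : e.1 ∈ Set.range (J.orderEmbOfFin rfl) := by
    rw [Finset.range_orderEmbOfFin]; exact he.1.1
  obtain ⟨b, hb⟩ : e.2 ∈ Set.range (J.orderEmbOfFin rfl) := by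
    rw [Finset.range_orderEmbOfFin]; exact he.1.2
  have hba : b ≤ a := (J.orderEmbOfFin rfl).le_iff_le.1 (by rw [ha, hb]; exact he.2)
  refine ⟨⟨(a, b), hba⟩, svec_pos ?_⟩
  rw [principal, Matrix.submatrix_apply, ha, hb]
  exact symUnit_pos e

theorem exists_entry_eq {n : ℕ} (F : Pattern n) {e : Fin n × Fin n} (he : e ∈ F) :
    ∃ α, entry F α = e := by
  have h : toLex (e.2, e.1) ∈ Set.range ((raster F).orderEmbOfFin rfl) := by
    rw [Finset.range_orderEmbOfFin]
    exact Finset.mem_image_of_mem (fun e : Fin n × Fin n => toLex (e.2, e.1)) he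
  obtain ⟨α, hα⟩ := h
  exact ⟨α, by rw [entry, hα]; rfl⟩

section Converted

variable {n m : ℕ} (C : Matrix (Fin n) (Fin n) ℝ) (A : Fin m → Matrix (Fin n) (Fin n) ℝ)
  (b : Fin m → ℝ)

theorem convertedSDP_ord_pos (k : (convertedSDP C A b).ι) : 1 ≤ (convertedSDP C A b).ord k := by
  rcases k with i | j
  · exact le_rfl
  · have h : (col (symbChol (aggPattern C A)) j).Nonempty := ⟨j, Finset.mem_insert_self _ _⟩
    exact h.card_pos

theorem card_convertedSDP_ι : Fintype.card (convertedSDP C A b).ι = m + n := by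
  have : Fintype.card (convertedSDP C A b).ι = @Fintype.card (Fin m ⊕ Fin n) inferInstance := rfl
  rw [this, Fintype.card_sum, Fintype.card_fin, Fintype.card_fin]

/-- The coordinates of the entries in one column set form a clique of the Schur complement
pattern. -/
theorem exists_schur_clique (j : Fin n) : ∃ K : Finset (Fin (convertedSDP C A b).p),
    cliquePattern K ⊆ (convertedSDP C A b).schurPattern ∧
      (col (symbChol (aggPattern C A)) j).card ^ 2 ≤ 2 * K.card := by
  set F := symbChol (aggPattern C A) with hF
  obtain ⟨K, hK⟩ : ∃ K : Finset (Fin (convertedSDP C A b).p),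
      ∀ α, α ∈ K ↔ entry F α ∈ cliquePattern (col F j) :=
    ⟨(Finset.univ.filter fun α => entry F α ∈ cliquePattern (col F j) :
      Finset (Fin (rasterCard F))), fun α => Finset.mem_filter_univ (α := Fin (rasterCard F)) α⟩
  refine ⟨K, ?_, ?_⟩
  · rintro ⟨α, β⟩ h
    simp only [cliquePattern, Finset.mem_filter, Finset.mem_product] at h
    have hα : entry F α ∈ cliquePattern (col F j) := (hK α).1 h.1.1
    have hβ : entry F β ∈ cliquePattern (col F j) := (hK β).1 h.1.2
    obtain ⟨u, hu⟩ := exists_svec_principal_symUnit_pos _ hα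
    obtain ⟨v, hv⟩ := exists_svec_principal_symUnit_pos _ hβ
    -- In the semidefinite block of `j` the data are minus the vectorizations of entrywise
    -- nonnegative matrices, which gives the required common sign.
    exact ConicSDP.mem_schurPattern (convertedSDP C A b) h.2 (Sum.inr j)
      (fun u => neg_nonpos.2 (svec_nonneg (fun _ _ => symUnit_nonneg _ _ _) u))
      (fun u => neg_nonpos.2 (svec_nonneg (fun _ _ => symUnit_nonneg _ _ _) u))
      (u₀ := u) (v₀ := v) (neg_lt_zero.2 hu) (neg_lt_zero.2 hv)
  -- Column sets are cliques of `F`, so every lower-triangular position inside one is the position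
  -- of some coordinate of `y`.
  · have hsub : cliquePattern (col F j) ⊆ K.image (entry F) := by
      intro e he
      obtain ⟨α, rfl⟩ := exists_entry_eq F (cliquePattern_col_subset _ j he)
      exact Finset.mem_image_of_mem _ ((hK α).2 he)
    have h1 := (Finset.card_le_card hsub).trans Finset.card_image_le
    exact (card_sq_le_two_mul_cliquePattern _).trans (Nat.mul_le_mul_left 2 h1)

theorem exists_schur_clique_frontsize : ∃ K : Finset (Fin (convertedSDP C A b).p),
    cliquePattern K ⊆ (convertedSDP C A b).schurPattern ∧
      frontsize (aggPattern C A) ^ 2 ≤ 2 * K.card := by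
  rcases (Finset.univ : Finset (Fin n)).eq_empty_or_nonempty with h | h
  · refine ⟨∅, by simp [cliquePattern], ?_⟩
    simp [frontsize, h]
  · obtain ⟨j, -, hj⟩ := Finset.exists_mem_eq_sup _ h
      fun j => (col (symbChol (aggPattern C A)) j).card
    obtain ⟨K, hK, hcard⟩ := exists_schur_clique C A b j
    exact ⟨K, hK, by rw [frontsize, hj]; exact hcard⟩

theorem frontsize_run_time (s : SchurInstance (convertedSDP C A b)) :
    48 * (m + n) + frontsize (aggPattern C A) ^ 6 ≤ 48 * s.run.time := by
  obtain ⟨K, hK, hcard⟩ := exists_schur_clique_frontsize C A b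
  have h1 := run_time_ge _ (convertedSDP_ord_pos C A b) s K hK
  rw [card_convertedSDP_ι] at h1
  -- From `ω² ≤ 2 |K|` follows `ω⁶ ≤ 8 |K|³`; combined with the factor `6` of the clique bound this
  -- makes `48`.
  have h2 := Nat.pow_le_pow_left hcard 3
  rw [← pow_mul, mul_pow] at h2
  norm_num at h2
  omega

theorem frontsize_run_mem (s : SchurInstance (convertedSDP C A b)) :
    8 * (m + n) + frontsize (aggPattern C A) ^ 4 ≤ 8 * s.run.mem := by
  obtain ⟨K, hK, hcard⟩ := exists_schur_clique_frontsize C A b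
  have h1 := run_mem_ge _ s K hK
  have h3 := card_ι_le_card_Col _ (convertedSDP_ord_pos C A b)
  rw [card_convertedSDP_ι] at h3
  -- Here `ω⁴ ≤ 4 |K|²`, and the factor `2` of the storage bound makes `8`.
  have h2 := Nat.pow_le_pow_left hcard 2
  rw [← pow_mul, mul_pow] at h2
  norm_num at h2
  omega

end Converted

/-! ## Executions -/

theorem mem_aggPattern {n m : ℕ} {C : Matrix (Fin n) (Fin n) ℝ}
    {A : Fin m → Matrix (Fin n) (Fin n) ℝ} {i j : Fin n} :
    (i, j) ∈ aggPattern C A ↔ j ≤ i ∧ (C i j ≠ 0 ∨ ∃ k, A k i j ≠ 0) := by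
  simp only [aggPattern, spar, Finset.mem_union, Finset.mem_filter, Finset.mem_univ, true_and,
    Finset.mem_biUnion]
  tauto

section Execution

variable {n m : ℕ} {C : Matrix (Fin n) (Fin n) ℝ} {A : Fin m → Matrix (Fin n) (Fin n) ℝ}
  {b : Fin m → ℝ} {π : Equiv.Perm (Fin n)}

/-- Patterns record only the lower triangle, and `π` may reverse the order of two indices; symmetry
of the data moves the nonzero to the other triangle. -/
theorem mem_reorderedPattern (hC : C.IsSymm) (hA : ∀ i, (A i).IsSymm) (π : Equiv.Perm (Fin n))
    {i j : Fin n} (hji : j < i) (h : (patternGraph (aggPattern C A)).Adj (π i) (π j)) :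
    (i, j) ∈ reorderedPattern C A π := by
  rw [patternGraph, SimpleGraph.fromRel_adj, mem_aggPattern, mem_aggPattern] at h
  rw [reorderedPattern, mem_aggPattern]
  refine ⟨hji.le, ?_⟩
  simp only [reorder, Matrix.submatrix_apply]
  rcases h.2 with h | h
  · exact h.2
  · rw [hC.apply] at h
    refine h.2.imp_right fun ⟨k, hk⟩ => ⟨k, ?_⟩
    rwa [(hA k).apply] at hk

theorem treewidth_le_frontsize_reorderedPattern (hC : C.IsSymm) (hA : ∀ i, (A i).IsSymm)
    (π : Equiv.Perm (Fin n)) :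
    treewidth (patternGraph (aggPattern C A)) ≤ frontsize (reorderedPattern C A π) := by
  -- For `n = 0` the frontsize is `0` and the strict bound fails, but the treewidth is `0` as well.
  rcases Nat.eq_zero_or_pos n with rfl | hn
  · rw [treewidth_of_isEmpty]
    exact Nat.zero_le _
  · have := treewidth_succ_le_frontsize hn _ _ π fun i j h => mem_reorderedPattern hC hA π h
    omega

theorem iteration_time_ge (it : Iteration (algSDP C A b π)) :
    48 * (m + n) + frontsize (reorderedPattern C A π) ^ 6 ≤ 48 * it.time := by
  obtain ⟨s, hs⟩ := it.time_ge
  exact (frontsize_run_time _ _ b s).trans (Nat.mul_le_mul_left _ hs)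

theorem iteration_mem_ge (it : Iteration (algSDP C A b π)) :
    8 * (m + n) + frontsize (reorderedPattern C A π) ^ 4 ≤ 8 * it.mem := by
  obtain ⟨s, hs⟩ := it.mem_ge
  exact (frontsize_run_mem _ _ b s).trans (Nat.mul_le_mul_left _ hs)

variable {S : GeneralPurposeSolver} {ε : ℝ}

theorem Execution.exists_iteration (e : Execution S ε C A b π) :
    ∃ it ∈ e.iterations, it.time ≤ e.time ∧ it.mem ≤ e.mem := by
  obtain ⟨it, hit⟩ := List.exists_mem_of_ne_nil _ (S.iterations_ne ε (algSDP C A b π))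
  refine ⟨it, hit, ?_, ?_⟩
  · have h := List.single_le_sum (fun _ _ => Nat.zero_le _) _
      (List.mem_map_of_mem (f := fun it : Iteration _ => it.time) hit)
    have h' : it.time ≤ (e.iterations.map fun it => it.time).sum := h
    unfold Execution.time
    omega
  · have h : it.mem ≤ (e.iterations.map fun it => it.mem).foldr max 0 :=
      le_foldr_max (List.mem_map_of_mem (f := fun it : Iteration _ => it.mem) hit)
    exact h.trans ((le_max_left _ _).trans (le_max_right _ _))

end Execution

/-! ## Fully dense instances -/

section Dense

variable {n m : ℕ}

/-- The constraint matrices `𝟏𝟏ᵀ + (i + 1) I`. -/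
def denseConstraint (n : ℕ) (i : ℕ) : Matrix (Fin n) (Fin n) ℝ :=
  (Matrix.of fun _ _ => 1) + ((i : ℝ) + 1) • 1

theorem onePlusOnes_isSymm (n : ℕ) : (onePlusOnes n).IsSymm := by
  ext i j
  simp [onePlusOnes, Matrix.one_apply, eq_comm]

theorem denseConstraint_isSymm (n i : ℕ) : (denseConstraint n i).IsSymm := by
  ext a b
  simp [denseConstraint, Matrix.one_apply, eq_comm]

theorem patternGraph_aggPattern_onePlusOnes (A : Fin m → Matrix (Fin n) (Fin n) ℝ) :
    patternGraph (aggPattern (onePlusOnes n) A) = ⊤ := by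
  ext i j
  rw [patternGraph, SimpleGraph.fromRel_adj, SimpleGraph.top_adj, mem_aggPattern, mem_aggPattern]
  refine and_iff_left_of_imp fun _ => ?_
  exact (le_total j i).imp (fun h => ⟨h, Or.inl (onePlusOnes_pos _ _).ne'⟩)
    fun h => ⟨h, Or.inl (onePlusOnes_pos _ _).ne'⟩

theorem patternGraph_extPattern_onePlusOnes (A : Fin m → Matrix (Fin n) (Fin n) ℝ) :
    patternGraph (extPattern (onePlusOnes n) A) = ⊤ := by
  ext i j
  rw [patternGraph, SimpleGraph.fromRel_adj, SimpleGraph.top_adj]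
  refine and_iff_left_of_imp fun _ => ?_
  simp only [extPattern, spar, Finset.mem_union, Finset.mem_filter, Finset.mem_univ, true_and]
  exact (le_total j i).imp (fun h => Or.inl ⟨h, (onePlusOnes_pos _ _).ne'⟩)
    fun h => Or.inl ⟨h, (onePlusOnes_pos _ _).ne'⟩

/-- Since `C ≻ 0` and the right-hand side is positive, `X = 0` and `v = 0` are feasible, both with
objective `0`. -/
theorem strongDualityAttained_onePlusOnes (A : Fin m → Matrix (Fin n) (Fin n) ℝ) :
    StrongDualityAttained (onePlusOnes n) A fun _ => 1 :=
  ⟨0, 0, Matrix.PosSemidef.zero, fun _ => le_rfl, fun i => by simp,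
    by simpa using (onePlusOnes_posDef n).posSemidef, by simp⟩

end Dense

end ChordalConv

theorem corollary4 :
    -- lower complexity: no permutation beats the bounds, with a universal constant
    (∃ c : ℝ, 0 < c ∧
      ∀ (n m : ℕ) (C : Matrix (Fin n) (Fin n) ℝ) (A : Fin m → Matrix (Fin n) (Fin n) ℝ)
        (b : Fin m → ℝ), C.IsSymm → (∀ i, (A i).IsSymm) →
      ∀ (π : Equiv.Perm (Fin n)) (S : GeneralPurposeSolver) (ε : ℝ), 0 < ε →
      ∀ e : Execution S ε C A b π,
        c * ((treewidth (patternGraph (aggPattern C A)) : ℝ) ^ 6 + m + n) ≤ e.time ∧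
        c * ((treewidth (patternGraph (aggPattern C A)) : ℝ) ^ 4 + m + n) ≤ e.mem) ∧
    -- sharpness when `G = Ḡ`: for every treewidth `τ` there are instances on which every iteration
    -- costs at least a constant times `ω⁴ N` time and `ω² N` memory, where `ω = τ + 1` and
    -- `N = m + ω n`
    (∃ c : ℝ, 0 < c ∧ ∀ τ m : ℕ, m ≤ (τ + 1) ^ 2 →
      ∃ (n : ℕ) (C : Matrix (Fin n) (Fin n) ℝ) (A : Fin m → Matrix (Fin n) (Fin n) ℝ)
        (b : Fin m → ℝ), C.IsSymm ∧ (∀ i, (A i).IsSymm) ∧ StrongDualityAttained C A b ∧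
        patternGraph (aggPattern C A) = patternGraph (extPattern C A) ∧
        treewidth (patternGraph (extPattern C A)) = τ ∧
        ∀ (π : Equiv.Perm (Fin n)) (S : GeneralPurposeSolver) (ε : ℝ), 0 < ε →
        ∀ e : Execution S ε C A b π, ∀ it ∈ e.iterations,
          c * (((τ : ℝ) + 1) ^ 4 * (m + ((τ : ℝ) + 1) * n)) ≤ it.time ∧
          c * (((τ : ℝ) + 1) ^ 2 * (m + ((τ : ℝ) + 1) * n)) ≤ it.mem) := by
  -- The time bound `ω⁶ ≤ 48 · time` sets both constants, memory needing only `8`; sharpness loses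
  -- another factor `2` from `N ≤ 2 (τ + 1)²`.
  refine ⟨⟨1 / 48, by norm_num, ?_⟩, ⟨1 / 96, by norm_num, ?_⟩⟩
  · intro n m C A b hC hA π S ε _ e
    obtain ⟨it, -, htime, hmem⟩ := e.exists_iteration
    have hτ := treewidth_le_frontsize_reorderedPattern hC hA π
    have h1 := (Nat.add_le_add_left (Nat.pow_le_pow_left hτ 6) _).trans
      ((iteration_time_ge it).trans (Nat.mul_le_mul_left 48 htime))
    have h2 := (Nat.add_le_add_left (Nat.pow_le_pow_left hτ 4) _).trans
      ((iteration_mem_ge it).trans (Nat.mul_le_mul_left 8 hmem))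
    have h1' : (48 : ℝ) * (m + n) + (treewidth (patternGraph (aggPattern C A)) : ℝ) ^ 6 ≤
      48 * e.time := by exact_mod_cast h1
    have h2' : (8 : ℝ) * (m + n) + (treewidth (patternGraph (aggPattern C A)) : ℝ) ^ 4 ≤
      8 * e.mem := by exact_mod_cast h2
    have hm : (0 : ℝ) ≤ m := m.cast_nonneg
    have hn : (0 : ℝ) ≤ n := n.cast_nonneg
    have hM : (0 : ℝ) ≤ e.mem := e.mem.cast_nonneg
    constructor <;> linarith
  · intro τ m hm
    refine ⟨τ + 1, onePlusOnes _, fun i => denseConstraint _ i, fun _ => 1, onePlusOnes_isSymm _,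
      fun i => denseConstraint_isSymm _ _, strongDualityAttained_onePlusOnes _, ?_, ?_, ?_⟩
    · rw [patternGraph_aggPattern_onePlusOnes, patternGraph_extPattern_onePlusOnes]
    · rw [patternGraph_extPattern_onePlusOnes, treewidth_top]
    intro π S ε _ e it _
    -- The strict form of the treewidth bound is needed here: the claim involves powers of `τ + 1`
    -- and includes `τ = 0`.
    have hω : τ + 1 ≤ frontsize (reorderedPattern (onePlusOnes (τ + 1))
        (fun i : Fin m => denseConstraint (τ + 1) i) π) := by
      have h := treewidth_succ_le_frontsize τ.succ_pos _ _ π fun i j h =>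
        mem_reorderedPattern (A := fun i : Fin m => denseConstraint (τ + 1) i)
          (onePlusOnes_isSymm _) (fun i => denseConstraint_isSymm _ _) π h
      rwa [patternGraph_aggPattern_onePlusOnes, treewidth_top] at h
    have h1 := (Nat.le_add_left _ _).trans ((Nat.add_le_add_left (Nat.pow_le_pow_left hω 6) _).trans
      (iteration_time_ge it))
    have h2 := (Nat.le_add_left _ _).trans ((Nat.add_le_add_left (Nat.pow_le_pow_left hω 4) _).trans
      (iteration_mem_ge it))
    have h1' : ((τ : ℝ) + 1) ^ 6 ≤ 48 * it.time := by exact_mod_cast h1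
    have h2' : ((τ : ℝ) + 1) ^ 4 ≤ 8 * it.mem := by exact_mod_cast h2
    have hN : (m : ℝ) + ((τ : ℝ) + 1) * ((τ + 1 : ℕ) : ℝ) ≤ 2 * ((τ : ℝ) + 1) ^ 2 := by
      have : (m : ℝ) ≤ ((τ : ℝ) + 1) ^ 2 := by exact_mod_cast hm
      push_cast
      linarith
    have h3 := mul_le_mul_of_nonneg_left hN (by positivity : (0 : ℝ) ≤ ((τ : ℝ) + 1) ^ 4)
    have h4 := mul_le_mul_of_nonneg_left hN (by positivity : (0 : ℝ) ≤ ((τ : ℝ) + 1) ^ 2)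
    have hM : (0 : ℝ) ≤ it.mem := it.mem.cast_nonneg
    constructor <;> linarith
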